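/- For a finite sequence $S=(s_1,\dots,s_r)$ of positive integers, some of which may carry a bar, and $n\ge 0$, put $$\zeta_n(S)=\sum_{n\ge k_1>k_2>\cdots>k_r\ge 1}\ \prod_{j=1}^{r}\frac{\varepsilon_j(k_j)}{k_j^{s_j}},\qquad \varepsilon_j(k)=\begin{cases}(-1)^k,& s_j\text{ barred},\\ 1,&\text{otherwise,}\end{cases}$$ and let $\zeta(S)=\lim_{n\to\infty}\zeta_n(S)$ whenever this limit exists. Write $\{1\}_a$ for the sequence of $a$ ones (empty if $a=0$). Theorem. Let $m,k\ge 1$ be integers. Then the limits defining all the values $\zeta(\cdot)$ below exist, and $$\begin{aligned} &(-1)^m\,\zeta(\bar 1,\{1\}_{m-1},3,\{1\}_{k-1})+(-1)^k\,\zeta(\bar 1,\{1\}_{k-1},3,\{1\}_{m-1})\\ &=\frac{(-1)^{m+1}}{m!}(\ln 2)^m\,\zeta(\bar 3,\{1\}_{k-1})+\frac{(-1)^{k+1}}{k!}(\ln 2)^k\,\zeta(\bar 3,\{1\}_{m-1})+\zeta(\bar 2,\{1\}_{m-1})\,\zeta(\bar 2,\{1\}_{k-1})\\ &\quad+(-1)^{m+1}\sum_{i=1}^{m-1}\frac{(\ln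 2)^i}{i!}\,\zeta(\bar 1,\{1\}_{m-i-1},3,\{1\}_{k-1})+(-1)^{k+1}\sum_{i=1}^{k-1}\frac{(\ln 2)^i}{i!}\,\zeta(\bar 1,\{1\}_{k-i-1},3,\{1\}_{m-1}). \end{aligned}$$ -/

import Mathlib

open Filter Topology

noncomputable section

/-- The multiple harmonic sum `ζ_n(s₁, …, s_r) = ∑_{n ≥ k₁ > ⋯ > k_r ≥ 1} ∏ⱼ εⱼ(kⱼ) / kⱼ ^ |sⱼ|`,
as the iterated finite sum (outermost, largest variable first). A barred entry `p̄` is encoded by the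
negative integer `-p`: `εⱼ(k) = (-1)^k` if `sⱼ < 0`, and `εⱼ(k) = 1` if `sⱼ > 0`.
The sum over the empty index is `1`. -/
def multHarmonic : List ℤ → ℕ → ℝ
  | [], _ => 1
  | s :: S, n => ∑ k ∈ Finset.Icc 1 n,
      (if s < 0 then (-1 : ℝ) ^ k else 1) / (k : ℝ) ^ s.natAbs * multHarmonic S (k - 1)

/-- The limit `lim_{n → ∞} ζ_n(S)` exists (in `ℝ`). -/
def MZVConverges (S : List ℤ) : Prop :=
  ∃ l : ℝ, Tendsto (multHarmonic S) atTop (𝓝 l)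

/-- The (alternating) multiple zeta value `ζ(S) = lim_{n → ∞} ζ_n(S)`. -/
def mzv (S : List ℤ) : ℝ :=
  limUnder atTop (multHarmonic S)

/-- The sequence `{1}_a` of `a` ones. -/
def ones (a : ℕ) : List ℤ :=
  List.replicate a 1

end

/-! Each alternating value is the limit at x = -1 of a power series Li_{s,S}(x), so the theorem
follows from an identity between such series on (-1, 1), `logMplSum_add_logMplSum`. Both sides of
that identity vanish at 0 and have equal derivatives: x d/dx lowers a first exponent above 1, (1 -
x) d/dx removes a leading 1, and Li_{{1}_n} = (-log(1 - x))^n / n!. The weighted sums of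
Li_{{1}_j,3,{1}_b} telescope under differentiation (`hasDerivAt_sum_log_mul`), while the product
Li_2 Li_2 cancels the terms where Li_3 is differentiated. Passing to x = -1 uses Abel's limit
theorem (`tendsto_mpl_neg`). Its hypothesis, convergence at the endpoint, comes from coefficients of
bounded variation that tend to 0. -/

/-- The `n`-th power series coefficient of the multiple polylogarithm with first exponent `s`. -/
noncomputable def mplCoeff (s : ℕ) (S : List ℤ) (n : ℕ) : ℝ :=
  multHarmonic S (n - 1) / (n : ℝ) ^ s

/-- The multiple polylogarithm `Li_{s, S}(x)` of one variable. -/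
noncomputable def mpl (s : ℕ) (S : List ℤ) (x : ℝ) : ℝ :=
  ∑' n, mplCoeff s S n * x ^ n

lemma mplCoeff_zero {s : ℕ} (hs : s ≠ 0) (S : List ℤ) : mplCoeff s S 0 = 0 := by
  simp [mplCoeff, hs]

lemma mul_mplCoeff_succ (s : ℕ) (S : List ℤ) (n : ℕ) :
    ((n : ℝ) + 1) * mplCoeff (s + 1) S (n + 1) = mplCoeff s S (n + 1) := by
  have : (n : ℝ) + 1 ≠ 0 := by positivity
  simp only [mplCoeff]
  push_cast
  field_simp
  ring

lemma multHarmonic_cons_succ (s : ℕ) (S : List ℤ) (n : ℕ) :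
    multHarmonic ((s : ℤ) :: S) (n + 1) =
      multHarmonic ((s : ℤ) :: S) n + mplCoeff s S (n + 1) := by
  simp only [multHarmonic, mplCoeff]
  rw [Finset.sum_Icc_succ_top (by omega)]
  have h : ¬ (s : ℤ) < 0 := by omega
  simp [h]
  ring

/-! ### Growth of multiple harmonic sums -/

lemma multHarmonic_nonneg {S : List ℤ} (hS : ∀ s ∈ S, 0 < s) (n : ℕ) :
    0 ≤ multHarmonic S n := by
  induction S generalizing n with
  | nil => simp [multHarmonic]
  | cons s S ih =>
    simp only [multHarmonic]
    have hs : ¬ s < 0 := by have := hS s (by simp); omega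
    simp only [hs, if_false]
    exact Finset.sum_nonneg fun k _ =>
      mul_nonneg (by positivity) (ih (fun t ht => hS t (by simp [ht])) _)

lemma mplCoeff_nonneg (s : ℕ) {S : List ℤ} (hS : ∀ s ∈ S, 0 < s) (n : ℕ) :
    0 ≤ mplCoeff s S n :=
  div_nonneg (multHarmonic_nonneg hS _) (by positivity)

lemma multHarmonic_mono {S : List ℤ} (hS : ∀ s ∈ S, 0 < s) : Monotone (multHarmonic S) := by
  cases S with
  | nil => intro a b _; simp [multHarmonic]
  | cons s S =>
    obtain ⟨t, rfl⟩ : ∃ t : ℕ, s = t := ⟨s.toNat, by have := hS s (by simp); omega⟩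
    refine monotone_nat_of_le_succ fun n => ?_
    rw [multHarmonic_cons_succ]
    linarith [mplCoeff_nonneg t (fun u hu => hS u (by simp [hu]) : ∀ u ∈ S, 0 < u) (n + 1)]

lemma multHarmonic_cons_le {s : ℤ} {S : List ℤ} (hs : 0 < s) (hS : ∀ s ∈ S, 0 < s) (n : ℕ) :
    multHarmonic (s :: S) n ≤ (harmonic n : ℝ) * multHarmonic S n := by
  rw [harmonic_eq_sum_Icc, Rat.cast_sum, Finset.sum_mul]
  simp only [multHarmonic, not_lt.mpr hs.le, if_false]
  refine Finset.sum_le_sum fun k hk => ?_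
  rw [Finset.mem_Icc] at hk
  have hk1 : (1 : ℝ) ≤ k := by exact_mod_cast hk.1
  refine mul_le_mul ?_ (multHarmonic_mono hS (by omega)) (multHarmonic_nonneg hS _)
    (by positivity)
  push_cast
  rw [one_div]
  exact inv_anti₀ (by positivity) (le_self_pow₀ hk1 (by omega))

lemma harmonic_isBigO_rpow {ε : ℝ} (hε : 0 < ε) :
    (fun n : ℕ => (harmonic n : ℝ)) =O[atTop] fun n => (n : ℝ) ^ ε := by
  have h1 : (fun x : ℝ => 1 + Real.log x) =O[atTop] fun x => x ^ ε :=
    (((Asymptotics.isLittleO_const_left_of_ne one_ne_zero).2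
      (tendsto_norm_atTop_atTop.comp (tendsto_rpow_atTop hε))).isBigO).add
      (isLittleO_log_rpow_atTop hε).isBigO
  refine Asymptotics.IsBigO.trans (Asymptotics.IsBigO.of_bound 1 ?_)
    (h1.comp_tendsto tendsto_natCast_atTop_atTop)
  filter_upwards with n
  have h2 := harmonic_le_one_add_log n
  have h3 : (0 : ℝ) ≤ harmonic n := by
    rw [harmonic, Rat.cast_sum]
    exact Finset.sum_nonneg fun i _ => by push_cast; positivity
  simp only [Function.comp, one_mul, Real.norm_eq_abs]
  rw [abs_of_nonneg h3]
  exact h2.trans (le_abs_self _)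

/-- Each entry costs at most a harmonic factor, hence a logarithm. The induction gives half of ε to
that factor and half to the tail. -/
lemma multHarmonic_isBigO_rpow {S : List ℤ} (hS : ∀ s ∈ S, 0 < s) {ε : ℝ} (hε : 0 < ε) :
    multHarmonic S =O[atTop] fun n => (n : ℝ) ^ ε := by
  induction S generalizing ε with
  | nil =>
    exact ((Asymptotics.isLittleO_const_left_of_ne one_ne_zero).2 (tendsto_norm_atTop_atTop.comp
      ((tendsto_rpow_atTop hε).comp tendsto_natCast_atTop_atTop))).isBigO
  | cons s S ih =>
    have hS' : ∀ s ∈ S, 0 < s := fun t ht => hS t (by simp [ht])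
    have h := (harmonic_isBigO_rpow (half_pos hε)).mul (ih hS' (half_pos hε))
    refine Asymptotics.IsBigO.trans (Asymptotics.IsBigO.of_bound 1 ?_)
      (h.congr_right fun n => ?_)
    · filter_upwards with n
      rw [one_mul, Real.norm_eq_abs, Real.norm_eq_abs, abs_of_nonneg (multHarmonic_nonneg hS n)]
      exact (multHarmonic_cons_le (hS s (by simp)) hS' n).trans (le_abs_self _)
    · rw [← Real.rpow_add_of_nonneg (by positivity) (half_pos hε).le (half_pos hε).le, add_halves]

lemma inv_add_one_isBigO : (fun n : ℕ => ((n : ℝ) + 1)⁻¹) =O[atTop] fun n : ℕ => (n : ℝ) ^ (-1 : ℝ) := by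
  refine Asymptotics.IsBigO.of_bound 1 ?_
  filter_upwards [eventually_gt_atTop 0] with n hn
  have : (0 : ℝ) < n := by exact_mod_cast hn
  rw [Real.rpow_neg_one, one_mul, Real.norm_eq_abs, Real.norm_eq_abs, abs_of_nonneg (by positivity),
    abs_of_nonneg (by positivity)]
  gcongr
  linarith

lemma mplCoeff_succ_isBigO {s : ℕ} (hs : s ≠ 0) {S : List ℤ} (hS : ∀ s ∈ S, 0 < s) :
    (fun n => mplCoeff s S (n + 1)) =O[atTop] fun n : ℕ => (n : ℝ) ^ (-(1 / 2) : ℝ) := by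
  have h := (multHarmonic_isBigO_rpow hS (ε := 1 / 2) (by norm_num)).mul inv_add_one_isBigO
  refine Asymptotics.IsBigO.trans (Asymptotics.IsBigO.of_bound 1 ?_) (h.trans_eventuallyEq ?_)
  · filter_upwards with n
    have h0 := multHarmonic_nonneg hS n
    have h1 : (1 : ℝ) ≤ n + 1 := by linarith [n.cast_nonneg (α := ℝ)]
    rw [one_mul, Real.norm_eq_abs, Real.norm_eq_abs, abs_of_nonneg (mplCoeff_nonneg s hS _),
      abs_of_nonneg (by positivity), mplCoeff, div_eq_mul_inv]
    push_cast
    gcongr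
    exact le_self_pow₀ h1 hs
  · filter_upwards [eventually_gt_atTop 0] with n hn
    rw [← Real.rpow_add (by exact_mod_cast hn)]
    norm_num

lemma mplCoeff_tendsto_zero {s : ℕ} (hs : s ≠ 0) {S : List ℤ} (hS : ∀ s ∈ S, 0 < s) :
    Tendsto (mplCoeff s S) atTop (𝓝 0) := by
  rw [← tendsto_add_atTop_iff_nat 1]
  exact (mplCoeff_succ_isBigO hs hS).trans_tendsto
    ((tendsto_rpow_neg_atTop (by norm_num)).comp tendsto_natCast_atTop_atTop)

/-! ### Convergence and Abel limits at -1 -/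

/-- Bounded variation replaces monotonicity in the alternating series test, so no eventual decrease
of the coefficients is needed. -/
lemma summable_mplCoeff_sub {s : ℕ} (hs : s ≠ 0) {S : List ℤ} (hS : ∀ s ∈ S, 0 < s) :
    Summable fun n => mplCoeff s S n - mplCoeff s S (n + 1) := by
  have hsum : Summable fun n : ℕ => (n : ℝ) ^ (-(3 / 2) : ℝ) := by
    rw [Real.summable_nat_rpow]; norm_num
  have hbig : ∀ {t : ℕ} {T : List ℤ}, t ≠ 0 → (∀ s ∈ T, 0 < s) →
      Summable fun n => mplCoeff t T (n + 1) * ((n : ℝ) + 1)⁻¹ := by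
    intro t T ht hT
    refine summable_of_isBigO_nat hsum
      (((mplCoeff_succ_isBigO ht hT).mul inv_add_one_isBigO).trans_eventuallyEq ?_)
    filter_upwards [eventually_gt_atTop 0] with n hn
    rw [← Real.rpow_add (by exact_mod_cast hn)]
    norm_num
  rw [← summable_nat_add_iff 1]
  rcases Nat.lt_or_ge s 2 with h2 | h2
  -- With H_n the sum for `S`, H_n/(n+1) - H_{n+1}/(n+2) = H_n/((n+1)(n+2)) - (H_{n+1} - H_n)/(n+2).
  -- The increment of H is again a coefficient, so both parts are O(n^(-3/2)).
  · obtain rfl : s = 1 := by omega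
    set d : ℕ → ℝ := fun n => multHarmonic S (n + 1) - multHarmonic S n with hd
    have hd0 : ∀ n, 0 ≤ d n := fun n => sub_nonneg.mpr (multHarmonic_mono hS n.le_succ)
    have hdsum : Summable fun n => d n * ((n : ℝ) + 1)⁻¹ := by
      cases S with
      | nil => simp [hd, multHarmonic, summable_zero]
      | cons t T =>
        have ht := hS t (by simp)
        obtain ⟨u, rfl⟩ : ∃ u : ℕ, t = u := ⟨t.toNat, by omega⟩
        refine (hbig (t := u) (T := T) (by omega) fun v hv => hS v (by simp [hv])).congr fun n => ?_
        simp [hd, multHarmonic_cons_succ]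
    have hd2 : Summable fun n => d n * ((n : ℝ) + 2)⁻¹ := by
      refine Summable.of_nonneg_of_le (fun n => mul_nonneg (hd0 n) (by positivity))
        (fun n => mul_le_mul_of_nonneg_left ?_ (hd0 n)) hdsum
      gcongr
      norm_num
    have h3 : Summable fun n => mplCoeff 1 S (n + 1) * ((n : ℝ) + 2)⁻¹ := by
      refine Summable.of_nonneg_of_le
        (fun n => mul_nonneg (mplCoeff_nonneg _ hS _) (by positivity))
        (fun n => mul_le_mul_of_nonneg_left ?_ (mplCoeff_nonneg _ hS _)) (hbig one_ne_zero hS)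
      gcongr
      norm_num
    refine (h3.sub hd2).congr fun n => ?_
    simp only [mplCoeff, hd]
    push_cast
    simp only [pow_one]
    have e1 : (n : ℝ) + 1 ≠ 0 := by positivity
    have e2 : (n : ℝ) + 2 ≠ 0 := by positivity
    have e3 : (n : ℝ) + 1 + 1 ≠ 0 := by positivity
    field_simp
    ring
  · obtain ⟨t, rfl⟩ : ∃ t, s = t + 2 := ⟨s - 2, by omega⟩
    have h1 : Summable fun n => mplCoeff (t + 2) S (n + 1) := by
      refine (hbig (t := t + 1) (by omega) hS).congr fun n => ?_
      have := mul_mplCoeff_succ (t + 1) S n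
      have e1 : (n : ℝ) + 1 ≠ 0 := by positivity
      rw [← this]
      field_simp
    exact h1.sub ((summable_nat_add_iff (f := fun n => mplCoeff (t + 2) S (n + 1)) 1).mpr h1)

/-- Summation by parts: twice the partial sum is ∑ (b_n - b_{n+1})(-1)^n + b_0 - b_N (-1)^N. -/
lemma exists_tendsto_alternating_sum {b : ℕ → ℝ} (hb : Tendsto b atTop (𝓝 0))
    (hd : Summable fun n => b n - b (n + 1)) :
    ∃ l, Tendsto (fun N => ∑ n ∈ Finset.range N, b n * (-1) ^ n) atTop (𝓝 l) := by
  have hs : Summable fun n => (b n - b (n + 1)) * (-1 : ℝ) ^ n := by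
    refine Summable.of_norm ?_
    simpa [abs_mul] using hd.abs
  have hb' : Tendsto (fun N => b N * (-1 : ℝ) ^ N) atTop (𝓝 0) := by
    rw [tendsto_zero_iff_abs_tendsto_zero] at hb ⊢
    simpa [abs_mul, Function.comp_def] using hb
  refine ⟨_, (((hs.hasSum.tendsto_sum_nat).add_const (b 0)).sub hb' |>.div_const 2).congr
    fun N => ?_⟩
  induction N with
  | zero => simp
  | succ N ih =>
    rw [Finset.sum_range_succ, Finset.sum_range_succ, ← ih]
    ring

lemma exists_tendsto_sum_mplCoeff {s : ℕ} (hs : s ≠ 0) {S : List ℤ} (hS : ∀ s ∈ S, 0 < s) :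
    ∃ l, Tendsto (fun N => ∑ n ∈ Finset.range N, mplCoeff s S n * (-1) ^ n) atTop (𝓝 l) :=
  exists_tendsto_alternating_sum (mplCoeff_tendsto_zero hs hS) (summable_mplCoeff_sub hs hS)

lemma multHarmonic_neg_cons {s : ℕ} (hs : s ≠ 0) (S : List ℤ) (n : ℕ) :
    multHarmonic (-(s : ℤ) :: S) n = ∑ k ∈ Finset.range (n + 1), mplCoeff s S k * (-1) ^ k := by
  have h : -(s : ℤ) < 0 := by omega
  rw [Finset.range_eq_Ico, Finset.sum_eq_sum_Ico_succ_bot (by omega), mplCoeff_zero hs, zero_mul,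
    zero_add, zero_add]
  simp only [multHarmonic, h, if_true]
  refine Finset.sum_congr rfl fun k _ => ?_
  rw [mplCoeff, Int.natAbs_neg, Int.natAbs_natCast]
  ring

lemma mzvConverges_neg_cons {s : ℕ} (hs : s ≠ 0) {S : List ℤ} (hS : ∀ s ∈ S, 0 < s) :
    MZVConverges (-(s : ℤ) :: S) := by
  obtain ⟨l, hl⟩ := exists_tendsto_sum_mplCoeff hs hS
  exact ⟨l, ((tendsto_add_atTop_iff_nat 1).mpr hl).congr fun n =>
    (multHarmonic_neg_cons hs S n).symm⟩

lemma tendsto_mpl_neg {s : ℕ} (hs : s ≠ 0) {S : List ℤ} (hS : ∀ s ∈ S, 0 < s) :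
    Tendsto (fun y => mpl s S (-y)) (𝓝[<] 1) (𝓝 (mzv (-(s : ℤ) :: S))) := by
  obtain ⟨l, hl⟩ := exists_tendsto_sum_mplCoeff hs hS
  have h : mzv (-(s : ℤ) :: S) = l :=
    (((tendsto_add_atTop_iff_nat 1).mpr hl).congr fun n =>
      (multHarmonic_neg_cons hs S n).symm).limUnder_eq
  rw [h]
  refine (Real.tendsto_tsum_powerSeries_nhdsWithin_lt hl).congr fun y => tsum_congr fun n => ?_
  rw [neg_pow]
  ring

/-! ### Differential equations on (-1, 1) -/

lemma summable_mul_pow_of_bounded {a : ℕ → ℝ} {C : ℝ} (ha : ∀ n, |a n| ≤ C) {x : ℝ}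
    (hx : x ∈ Set.Ioo (-1 : ℝ) 1) : Summable fun n => a n * x ^ n := by
  have hx' : |x| < 1 := abs_lt.mpr hx
  refine Summable.of_norm_bounded
    ((summable_geometric_of_lt_one (abs_nonneg x) hx').mul_left C) fun n => ?_
  rw [Real.norm_eq_abs, abs_mul, abs_pow]
  gcongr
  exact ha n

lemma hasDerivAt_tsum_mul_pow {a : ℕ → ℝ} {C : ℝ} (ha : ∀ n, |a n| ≤ C) {x : ℝ}
    (hx : x ∈ Set.Ioo (-1 : ℝ) 1) :
    HasDerivAt (fun x => ∑' n, a n * x ^ n) (∑' n : ℕ, ((n : ℝ) + 1) * a (n + 1) * x ^ n) x := by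
  obtain ⟨r, hxr, hr⟩ := exists_between (abs_lt.mpr hx)
  have hr0 : 0 ≤ r := (abs_nonneg x).trans hxr.le
  have hg : Summable fun n : ℕ => (n : ℝ) * r ^ n := by
    simpa using summable_pow_mul_geometric_of_norm_lt_one 1 (r := r)
      (by rwa [Real.norm_eq_abs, abs_of_nonneg hr0])
  have hu : Summable fun n : ℕ => C * (n * r ^ (n - 1)) := by
    refine Summable.mul_left C ((summable_nat_add_iff 1).mp ?_)
    refine (hg.add (summable_geometric_of_lt_one hr0 hr)).congr fun n => ?_
    push_cast
    ring
  have hbound : ∀ (n : ℕ), ∀ y ∈ Set.Ioo (-r) r,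
      ‖a n * (n * y ^ (n - 1))‖ ≤ C * (n * r ^ (n - 1)) := by
    intro n y hy
    have hy' : |y| ≤ r := (abs_lt.mpr hy).le
    rw [Real.norm_eq_abs, abs_mul, abs_mul, abs_pow, Nat.abs_cast]
    have := ha n
    have := (abs_nonneg _).trans this
    gcongr
  have hxm : x ∈ Set.Ioo (-r) r := abs_lt.mp hxr
  have h := hasDerivAt_tsum_of_isPreconnected hu isOpen_Ioo isPreconnected_Ioo
    (fun n y _ => (hasDerivAt_pow n y).const_mul (a n)) hbound hxm
    (summable_mul_pow_of_bounded ha hx) hxm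
  refine h.congr_deriv ?_
  rw [(Summable.of_norm_bounded hu fun n => hbound n x hxm).tsum_eq_zero_add]
  simp only [Nat.cast_zero, zero_mul, mul_zero, zero_add]
  refine tsum_congr fun n => ?_
  push_cast
  ring

lemma exists_mplCoeff_le {s : ℕ} (hs : s ≠ 0) {S : List ℤ} (hS : ∀ s ∈ S, 0 < s) :
    ∃ C, ∀ n, |mplCoeff s S n| ≤ C := by
  obtain ⟨C, hC⟩ := (mplCoeff_tendsto_zero hs hS).abs.bddAbove_range
  exact ⟨C, fun n => hC ⟨n, rfl⟩⟩

lemma summable_mplCoeff_mul_pow {s : ℕ} (hs : s ≠ 0) {S : List ℤ} (hS : ∀ s ∈ S, 0 < s) {x : ℝ}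
    (hx : x ∈ Set.Ioo (-1 : ℝ) 1) : Summable fun n => mplCoeff s S n * x ^ n := by
  obtain ⟨C, hC⟩ := exists_mplCoeff_le hs hS
  exact summable_mul_pow_of_bounded hC hx

lemma mpl_zero_right {s : ℕ} (hs : s ≠ 0) (S : List ℤ) : mpl s S 0 = 0 := by
  rw [mpl, tsum_eq_single 0 fun n hn => by simp [hn], mplCoeff_zero hs, zero_mul]

/-- Stating `x * d` rather than dividing by x keeps the point 0 in the domain. -/
lemma exists_hasDerivAt_mpl_succ {s : ℕ} (hs : s ≠ 0) {S : List ℤ} (hS : ∀ s ∈ S, 0 < s) {x : ℝ}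
    (hx : x ∈ Set.Ioo (-1 : ℝ) 1) :
    ∃ d, HasDerivAt (mpl (s + 1) S) d x ∧ x * d = mpl s S x := by
  obtain ⟨C, hC⟩ := exists_mplCoeff_le s.succ_ne_zero hS
  refine ⟨_, hasDerivAt_tsum_mul_pow hC hx, ?_⟩
  rw [mpl, (summable_mplCoeff_mul_pow hs hS hx).tsum_eq_zero_add, mplCoeff_zero hs, zero_mul,
    zero_add, ← tsum_mul_left]
  refine tsum_congr fun n => ?_
  rw [Nat.succ_eq_add_one, mul_mplCoeff_succ]
  ring

/-- The derivative has coefficients `multHarmonic (s :: S) n`, the partial sums of `mplCoeff s S`;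
multiplying by 1 - x takes their differences. -/
lemma hasDerivAt_mpl_one_cons {s : ℕ} (hs : s ≠ 0) {S : List ℤ} (hS : ∀ s ∈ S, 0 < s) {x : ℝ}
    (hx : x ∈ Set.Ioo (-1 : ℝ) 1) :
    HasDerivAt (mpl 1 ((s : ℤ) :: S)) (mpl s S x / (1 - x)) x := by
  have hS' : ∀ t ∈ (s : ℤ) :: S, 0 < t := by
    intro t ht
    rcases List.mem_cons.mp ht with rfl | h
    · omega
    · exact hS t h
  obtain ⟨C, hC⟩ := exists_mplCoeff_le one_ne_zero hS'
  have hx1 : 1 - x ≠ 0 := by linarith [hx.2]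
  refine (hasDerivAt_tsum_mul_pow hC hx).congr_deriv (Eq.symm ?_)
  have hterm : ∀ n : ℕ, ((n : ℝ) + 1) * mplCoeff 1 ((s : ℤ) :: S) (n + 1) =
      multHarmonic ((s : ℤ) :: S) n := fun n => by
    have : (n : ℝ) + 1 ≠ 0 := by positivity
    simp only [mplCoeff]
    push_cast
    field_simp
  simp only [hterm]
  have hz : multHarmonic ((s : ℤ) :: S) 0 = 0 := by simp [multHarmonic]
  have hsum : Summable fun n => multHarmonic ((s : ℤ) :: S) n * x ^ n := by
    obtain ⟨C, hC⟩ := exists_mplCoeff_le hs hS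
    -- Linear growth, from bounded increments, already gives absolute convergence.
    have hle : ∀ n : ℕ, multHarmonic ((s : ℤ) :: S) n ≤ C * n := by
      intro n
      induction n with
      | zero => simp [hz]
      | succ n ih =>
        rw [multHarmonic_cons_succ]
        push_cast
        linarith [(le_abs_self _).trans (hC (n + 1))]
    have hg : Summable fun n : ℕ => (n : ℝ) * |x| ^ n := by
      simpa using summable_pow_mul_geometric_of_norm_lt_one 1 (r := |x|)
        (by rw [Real.norm_eq_abs, abs_abs]; exact abs_lt.mpr hx)
    refine Summable.of_norm_bounded (hg.mul_left C) fun n => ?_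
    rw [Real.norm_eq_abs, abs_mul, abs_pow, abs_of_nonneg (multHarmonic_nonneg hS' n), ← mul_assoc]
    gcongr
    exact hle n
  rw [div_eq_iff hx1, mul_one_sub, eq_sub_iff_add_eq, mpl,
    (summable_mplCoeff_mul_pow hs hS hx).tsum_eq_zero_add, mplCoeff_zero hs, zero_mul, zero_add,
    ← tsum_mul_right, ← Summable.tsum_add _ (hsum.mul_right x), hsum.tsum_eq_zero_add, hz, zero_mul,
    zero_add]
  · refine tsum_congr fun n => ?_
    rw [multHarmonic_cons_succ]
    ring
  · exact (summable_nat_add_iff 1).mpr (summable_mplCoeff_mul_pow hs hS hx)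

lemma eqOn_Ioo_of_hasDerivAt {f g : ℝ → ℝ} {d : ℝ → ℝ}
    (hf : ∀ x ∈ Set.Ioo (-1 : ℝ) 1, HasDerivAt f (d x) x)
    (hg : ∀ x ∈ Set.Ioo (-1 : ℝ) 1, HasDerivAt g (d x) x) (h0 : f 0 = g 0) :
    Set.EqOn f g (Set.Ioo (-1 : ℝ) 1) := by
  intro x hx
  have h := isOpen_Ioo.is_const_of_deriv_eq_zero (f := f - g) isPreconnected_Ioo
    (fun y hy => ((hf y hy).sub (hg y hy)).differentiableAt.differentiableWithinAt)
    (fun y hy => by rw [((hf y hy).sub (hg y hy)).deriv, sub_self, Pi.zero_apply]) hx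
    (show (0 : ℝ) ∈ Set.Ioo (-1 : ℝ) 1 by simp)
  simp only [Pi.sub_apply, h0, sub_self] at h
  linarith

lemma hasDerivAt_log_one_sub_pow (n : ℕ) {x : ℝ} (hx : x ∈ Set.Ioo (-1 : ℝ) 1) :
    HasDerivAt (fun x => Real.log (1 - x) ^ (n + 1) / ((n + 1).factorial : ℝ))
      (-(Real.log (1 - x) ^ n / (n.factorial : ℝ) / (1 - x))) x := by
  have hx1 : 1 - x ≠ 0 := by linarith [hx.2]
  have h := ((((hasDerivAt_id x).const_sub 1).log hx1).pow (n + 1)).div_const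
    ((n + 1).factorial : ℝ)
  refine h.congr_deriv ?_
  rw [Nat.factorial_succ]
  have : ((n : ℝ) + 1) ≠ 0 := by positivity
  have : (n.factorial : ℝ) ≠ 0 := by positivity
  push_cast
  simp only [id]
  field_simp

lemma ones_pos (a : ℕ) : ∀ s ∈ ones a, 0 < s := by
  intro s hs
  rw [List.eq_of_mem_replicate hs]
  norm_num

lemma ones_succ_append (a : ℕ) (S : List ℤ) : ones (a + 1) ++ S = ((1 : ℕ) : ℤ) :: (ones a ++ S) := by
  simp [ones, List.replicate_succ]

lemma mpl_one_ones (n : ℕ) {x : ℝ} (hx : x ∈ Set.Ioo (-1 : ℝ) 1) :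
    mpl 1 (ones n) x = (-1) ^ (n + 1) * (Real.log (1 - x) ^ (n + 1) / ((n + 1).factorial : ℝ)) := by
  induction n generalizing x with
  | zero =>
    have h := Real.hasSum_pow_div_log_of_abs_lt_one (abs_lt.mpr hx)
    rw [mpl, (summable_mplCoeff_mul_pow one_ne_zero (ones_pos 0) hx).tsum_eq_zero_add,
      mplCoeff_zero one_ne_zero, zero_mul, zero_add]
    have : ∀ n : ℕ, mplCoeff 1 (ones 0) (n + 1) * x ^ (n + 1) = x ^ (n + 1) / (n + 1) := fun n => by
      simp [mplCoeff, ones, multHarmonic]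
      ring
    simp only [this]
    rw [h.tsum_eq]
    simp
  | succ n ih =>
    refine eqOn_Ioo_of_hasDerivAt (d := fun x => mpl 1 (ones n) x / (1 - x))
      (g := fun x => (-1) ^ (n + 1 + 1) *
        (Real.log (1 - x) ^ (n + 1 + 1) / ((n + 1 + 1).factorial : ℝ)))
      (fun y hy => ?_) (fun y hy => ?_) ?_ hx
    · have := hasDerivAt_mpl_one_cons one_ne_zero (ones_pos n) hy
      simpa [ones, List.replicate_succ] using this
    · refine ((hasDerivAt_log_one_sub_pow (n + 1) hy).const_mul _).congr_deriv ?_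
      rw [ih hy]
      ring
    · simp [mpl_zero_right]

/-! ### The polylogarithmic identity -/

/-- Differentiating the logarithm in one term cancels differentiating G in the preceding one; only
the last G-derivative survives. The shift `c` serves the induction: all but the last term for (n +
1, c) form the sum for (n, c + 1). -/
lemma hasDerivAt_sum_log_mul {G : ℕ → ℝ → ℝ} {x : ℝ} (hx : x ∈ Set.Ioo (-1 : ℝ) 1)
    (hG : ∀ j, HasDerivAt (G (j + 1)) (G j x / (1 - x)) x) (n c : ℕ) :
    HasDerivAt (fun x => ∑ i ∈ Finset.range (n + 1),
        Real.log (1 - x) ^ i / (i.factorial : ℝ) * G (n + c + 1 - i) x)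
      (Real.log (1 - x) ^ n / (n.factorial : ℝ) * (G c x / (1 - x))) x := by
  induction n generalizing c with
  | zero => simpa using hG c
  | succ n ih =>
    simp only [Finset.sum_range_succ _ (n + 1)]
    have e : n + 1 + c + 1 - (n + 1) = c + 1 := by omega
    rw [e]
    have h1 := ih (c + 1)
    simp only [show n + (c + 1) + 1 = n + 1 + c + 1 by ring] at h1
    refine (h1.add ((hasDerivAt_log_one_sub_pow n hx).mul (hG c))).congr_deriv ?_
    ring

/-- Iterated integrals of `Li_{3, {1}_b}` against `dx / (1 - x)`, as multiple polylogarithms. -/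
noncomputable def iteratedMpl (b : ℕ) : ℕ → ℝ → ℝ
  | 0 => mpl 3 (ones b)
  | j + 1 => mpl 1 (ones j ++ ([3] ++ ones b))

lemma ones_append_three_pos (a b : ℕ) : ∀ s ∈ ones a ++ ([3] ++ ones b), 0 < s := by
  intro s hs
  simp only [List.mem_append, List.mem_singleton] at hs
  rcases hs with h | h | h
  · exact ones_pos a s h
  · omega
  · exact ones_pos b s h

lemma hasDerivAt_iteratedMpl (b j : ℕ) {x : ℝ} (hx : x ∈ Set.Ioo (-1 : ℝ) 1) :
    HasDerivAt (iteratedMpl b (j + 1)) (iteratedMpl b j x / (1 - x)) x := by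
  cases j with
  | zero => exact hasDerivAt_mpl_one_cons three_ne_zero (ones_pos b) hx
  | succ j =>
    simp only [iteratedMpl, ones_succ_append]
    exact hasDerivAt_mpl_one_cons one_ne_zero (ones_append_three_pos j b) hx

/-- The sum `∑_{i ≤ a} log(1 - x)^i / i! * Li_{{1}_{a + 1 - i}, 3, {1}_b}(x)`. -/
noncomputable def logMplSum (a b : ℕ) (x : ℝ) : ℝ :=
  ∑ i ∈ Finset.range (a + 1),
    Real.log (1 - x) ^ i / (i.factorial : ℝ) * iteratedMpl b (a + 1 - i) x

lemma hasDerivAt_logMplSum (a b : ℕ) {x : ℝ} (hx : x ∈ Set.Ioo (-1 : ℝ) 1) :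
    HasDerivAt (logMplSum a b)
      (Real.log (1 - x) ^ a / (a.factorial : ℝ) * (mpl 3 (ones b) x / (1 - x))) x :=
  hasDerivAt_sum_log_mul hx (fun j => hasDerivAt_iteratedMpl b j hx) a 0

lemma logMplSum_zero_right (a b : ℕ) : logMplSum a b 0 = 0 := by
  refine Finset.sum_eq_zero fun i hi => ?_
  rw [Finset.mem_range] at hi
  obtain ⟨j, hj⟩ : ∃ j, a + 1 - i = j + 1 := ⟨a - i, by omega⟩
  rw [hj, iteratedMpl, mpl_zero_right one_ne_zero, mul_zero]

/-- The polylogarithmic identity on `(-1, 1)` that specializes to alternating multiple zeta values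
at `x = -1`. -/
lemma logMplSum_add_logMplSum (a b : ℕ) {x : ℝ} (hx : x ∈ Set.Ioo (-1 : ℝ) 1) :
    (-1) ^ a * logMplSum a b x + (-1) ^ b * logMplSum b a x =
      (-1) ^ (a + 1) * (Real.log (1 - x) ^ (a + 1) / ((a + 1).factorial : ℝ)) * mpl 3 (ones b) x +
      (-1) ^ (b + 1) * (Real.log (1 - x) ^ (b + 1) / ((b + 1).factorial : ℝ)) * mpl 3 (ones a) x -
      mpl 2 (ones a) x * mpl 2 (ones b) x := by
  refine eqOn_Ioo_of_hasDerivAt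
    (d := fun x =>
      (-1) ^ a * (Real.log (1 - x) ^ a / (a.factorial : ℝ) * (mpl 3 (ones b) x / (1 - x))) +
      (-1) ^ b * (Real.log (1 - x) ^ b / (b.factorial : ℝ) * (mpl 3 (ones a) x / (1 - x))))
    (f := fun x => (-1) ^ a * logMplSum a b x + (-1) ^ b * logMplSum b a x)
    (g := fun x =>
      (-1) ^ (a + 1) * (Real.log (1 - x) ^ (a + 1) / ((a + 1).factorial : ℝ)) * mpl 3 (ones b) x +
      (-1) ^ (b + 1) * (Real.log (1 - x) ^ (b + 1) / ((b + 1).factorial : ℝ)) * mpl 3 (ones a) x -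
      mpl 2 (ones a) x * mpl 2 (ones b) x)
    (fun y hy => ((hasDerivAt_logMplSum a b hy).const_mul _).add
      ((hasDerivAt_logMplSum b a hy).const_mul _)) (fun y hy => ?_) ?_ hx
  -- Writing Li_{{1}_{a+1}} = x Li_{2,{1}_a}' and Li_{2,{1}_b} = x Li_{3,{1}_b}', both
  -- Li_{{1}_{a+1}} Li_{3,{1}_b}' and Li_{2,{1}_a}' Li_{2,{1}_b} equal x Li_{2,{1}_a}'
  -- Li_{3,{1}_b}'. They cancel, also at x = 0, as does the pair with a and b exchanged.
  · obtain ⟨fa, hfa, ea⟩ := exists_hasDerivAt_mpl_succ one_ne_zero (ones_pos a) hy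
    obtain ⟨fb, hfb, eb⟩ := exists_hasDerivAt_mpl_succ one_ne_zero (ones_pos b) hy
    obtain ⟨ga, hga, ea'⟩ := exists_hasDerivAt_mpl_succ two_ne_zero (ones_pos a) hy
    obtain ⟨gb, hgb, eb'⟩ := exists_hasDerivAt_mpl_succ two_ne_zero (ones_pos b) hy
    refine (((((hasDerivAt_log_one_sub_pow a hy).const_mul _).mul hgb).add
      (((hasDerivAt_log_one_sub_pow b hy).const_mul _).mul hga)).sub
        (hfa.mul hfb)).congr_deriv ?_
    rw [← mpl_one_ones a hy, ← mpl_one_ones b hy, ← ea, ← eb, ← ea', ← eb']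
    ring
  · simp [logMplSum_zero_right, mpl_zero_right]

/-! ### Specialization at x = -1 -/

/-- The value at `-1` of `iteratedMpl b j`. -/
noncomputable def iteratedMzv (b : ℕ) : ℕ → ℝ
  | 0 => mzv ([-3] ++ ones b)
  | j + 1 => mzv ([-1] ++ ones j ++ [3] ++ ones b)

lemma tendsto_iteratedMpl (b j : ℕ) :
    Tendsto (fun y => iteratedMpl b j (-y)) (𝓝[<] 1) (𝓝 (iteratedMzv b j)) := by
  cases j with
  | zero => exact tendsto_mpl_neg three_ne_zero (ones_pos b)
  | succ j =>
    simp only [iteratedMzv, List.append_assoc]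
    exact tendsto_mpl_neg one_ne_zero (ones_append_three_pos j b)

lemma tendsto_log_one_sub_neg_pow (i : ℕ) :
    Tendsto (fun y : ℝ => Real.log (1 - -y) ^ i / (i.factorial : ℝ)) (𝓝[<] 1)
      (𝓝 (Real.log 2 ^ i / (i.factorial : ℝ))) := by
  have h : ContinuousAt (fun y : ℝ => Real.log (1 - -y) ^ i / (i.factorial : ℝ)) 1 := by
    refine ((ContinuousAt.log (by fun_prop) (by norm_num)).pow i).div_const _
  have h2 := h.tendsto.mono_left (nhdsWithin_le_nhds (s := Set.Iio 1))
  norm_num at h2 ⊢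
  exact h2

lemma tendsto_logMplSum (a b : ℕ) :
    Tendsto (fun y => logMplSum a b (-y)) (𝓝[<] 1) (𝓝 (∑ i ∈ Finset.range (a + 1),
      Real.log 2 ^ i / (i.factorial : ℝ) * iteratedMzv b (a + 1 - i))) :=
  tendsto_finsetSum _ fun i _ => (tendsto_log_one_sub_neg_pow i).mul (tendsto_iteratedMpl b _)

lemma sum_iteratedMzv_eq (a b : ℕ) :
    ∑ i ∈ Finset.range (a + 1), Real.log 2 ^ i / (i.factorial : ℝ) * iteratedMzv b (a + 1 - i) =
      mzv ([-1] ++ ones a ++ [3] ++ ones b) +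
        ∑ i ∈ Finset.Icc 1 a, Real.log 2 ^ i / (i.factorial : ℝ) *
          mzv ([-1] ++ ones (a + 1 - i - 1) ++ [3] ++ ones b) := by
  rw [Finset.range_eq_Ico, Finset.sum_eq_sum_Ico_succ_bot (by omega)]
  congr 1
  · simp [iteratedMzv]
  · refine Finset.sum_congr (by ext; simp) fun i hi => ?_
    rw [Finset.mem_Icc] at hi
    obtain ⟨j, hj⟩ : ∃ j, a + 1 - i = j + 1 := ⟨a - i, by omega⟩
    rw [hj, iteratedMzv, Nat.add_sub_cancel]

theorem theorem2p4 (m k : ℕ) (hm : 1 ≤ m) (hk : 1 ≤ k) :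
    (∀ i < m, MZVConverges ([-1] ++ ones i ++ [3] ++ ones (k - 1))) ∧
    (∀ i < k, MZVConverges ([-1] ++ ones i ++ [3] ++ ones (m - 1))) ∧
    MZVConverges ([-3] ++ ones (k - 1)) ∧
    MZVConverges ([-3] ++ ones (m - 1)) ∧
    MZVConverges ([-2] ++ ones (m - 1)) ∧
    MZVConverges ([-2] ++ ones (k - 1)) ∧
    (-1 : ℝ) ^ m * mzv ([-1] ++ ones (m - 1) ++ [3] ++ ones (k - 1))
        + (-1 : ℝ) ^ k * mzv ([-1] ++ ones (k - 1) ++ [3] ++ ones (m - 1))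
      = (-1 : ℝ) ^ (m + 1) / (m.factorial : ℝ) * Real.log 2 ^ m * mzv ([-3] ++ ones (k - 1))
        + (-1 : ℝ) ^ (k + 1) / (k.factorial : ℝ) * Real.log 2 ^ k * mzv ([-3] ++ ones (m - 1))
        + mzv ([-2] ++ ones (m - 1)) * mzv ([-2] ++ ones (k - 1))
        + (-1 : ℝ) ^ (m + 1) * ∑ i ∈ Finset.Icc 1 (m - 1),
            Real.log 2 ^ i / (i.factorial : ℝ)
              * mzv ([-1] ++ ones (m - i - 1) ++ [3] ++ ones (k - 1))
        + (-1 : ℝ) ^ (k + 1) * ∑ i ∈ Finset.Icc 1 (k - 1),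
            Real.log 2 ^ i / (i.factorial : ℝ)
              * mzv ([-1] ++ ones (k - i - 1) ++ [3] ++ ones (m - 1)) := by
  obtain ⟨a, rfl⟩ : ∃ a, m = a + 1 := ⟨m - 1, by omega⟩
  obtain ⟨b, rfl⟩ : ∃ b, k = b + 1 := ⟨k - 1, by omega⟩
  simp only [Nat.add_sub_cancel]
  have conv_one : ∀ i c : ℕ, MZVConverges ([-1] ++ ones i ++ [3] ++ ones c) := fun i c => by
    rw [List.append_assoc, List.append_assoc]
    exact mzvConverges_neg_cons one_ne_zero (ones_append_three_pos i c)
  refine ⟨fun i _ => conv_one i b, fun i _ => conv_one i a,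
    mzvConverges_neg_cons three_ne_zero (ones_pos b),
    mzvConverges_neg_cons three_ne_zero (ones_pos a),
    mzvConverges_neg_cons two_ne_zero (ones_pos a),
    mzvConverges_neg_cons two_ne_zero (ones_pos b), ?_⟩
  have hleft := ((tendsto_logMplSum a b).const_mul ((-1) ^ a)).add
    ((tendsto_logMplSum b a).const_mul ((-1) ^ b))
  have hright := ((((tendsto_log_one_sub_neg_pow (a + 1)).const_mul ((-1) ^ (a + 1))).mul
      (tendsto_mpl_neg three_ne_zero (ones_pos b))).add
    (((tendsto_log_one_sub_neg_pow (b + 1)).const_mul ((-1) ^ (b + 1))).mul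
      (tendsto_mpl_neg three_ne_zero (ones_pos a)))).sub
    ((tendsto_mpl_neg two_ne_zero (ones_pos a)).mul (tendsto_mpl_neg two_ne_zero (ones_pos b)))
  have hlim := tendsto_nhds_unique (hleft.congr' ?_) hright
  · rw [sum_iteratedMzv_eq, sum_iteratedMzv_eq] at hlim
    simp only [List.singleton_append] at hlim ⊢
    push_cast at hlim ⊢
    -- The sign appears because the identity carries (-1)^a, with a = m - 1, where the theorem has
    -- (-1)^m.
    linear_combination -hlim
  · filter_upwards [Ioo_mem_nhdsLT (show (0 : ℝ) < 1 by norm_num)] with y hy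
    exact logMplSum_add_logMplSum a b ⟨by linarith [hy.2], by linarith [hy.1]⟩
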